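/- Let $n\ge 0$ be an integer, let $\tau\ge 0$, $\zeta\ge 0$, $a,b>0$ be real, and let $C_s,r_s,C_\tau,C_r,a_0,a_1,a_2$ be real numbers. Let $\lambda$ have the gamma prior with density $\frac{b^a}{\Gamma(a)}\lambda^{a-1}e^{-b\lambda}$, $\lambda>0$, and, given $\lambda$, let $X_1,\dots,X_n$ be independent exponential lifetimes with density $\lambda e^{-\lambda x}$, $x>0$. Under Type-I censoring at time $\tau$, let $X_{(1)}\le\dots\le X_{(n)}$ be the ordered lifetimes, let $M$ be the number of $i$ with $X_i\le\tau$, and put $$\widehat\lambda=0 \text{ if } M=0,\qquad \widehat\lambda=\frac{M}{\sum_{i=1}^{M}X_{(i)}+(n-M)\tau}\ \text{ (the maximum likelihood estimator) if } M>0 .$$ The batch is accepted if $\widehat\lambda<\zeta$ and rejected if $\widehat\lambda\ge\zeta$, and the loss is $$L=\begin{cases} nC_s-(n-M)r_s+\tau C_\tau+a_0+a_1\lambda+a_2\lambda^2 & \text{if the batch is accepted},\\ nC_s-(n-M)r_s+\tau C_\tau+C_r & \text{if the batch is rejected.}\end{cases}$$ Then the expectations in the Bayes risk $r(n,\tau,\zeta)=E_\lambda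 E_{X\mid\lambda}(L)$, in $E(M)=E_\lambda E_{X\mid\lambda}(M)$ and in $\mu_i=E(\lambda^i)$ ($i=1,2$) exist, and $$\begin{aligned} r(n,\tau,\zeta)={}& n(C_s-r_s)+E(M)\,r_s+\tau C_\tau+a_0+a_1\mu_1+a_2\mu_2\\ &+\sum_{l=0}^{2}C_l\frac{b^a}{\Gamma(a)}\Bigg[\frac{\Gamma(a+l)}{(b+n\tau)^{a+l}}\,\mathbf 1_{\{\zeta=0\}}+\sum_{m=1}^{n}\sum_{j=0}^{m}(-1)^j\binom nm\binom mj\frac{\Gamma(a+l)}{C_{j,m}^{\,a+l}}\,I_{S^*_{j,m}}(m,a+l)\Bigg],\end{aligned}$$ $$E(M)=\sum_{m=1}^{n}\sum_{j=0}^{m}m\binom nm\binom mj(-1)^j\frac{b^a}{(b+(n-m+j)\tau)^a}.$$ Here $C_0=C_r-a_0$, $C_1=-a_1$, $C_2=-a_2$; $\tau_{j,m}=(n-m+j)\frac{\tau}{m}$, $C_{j,m}=b+m\tau_{j,m}$; for $\zeta>0$, $C^*_{j,m}=\frac{m(1/\zeta-\tau_{j,m})}{C_{j,m}}$ and $S^*_{j,m}=\frac{C^*_{j,m}}{1+C^*_{j,m}}$,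 while $S^*_{j,m}=1$ for $\zeta=0$; and $I_x(\alpha,\beta)$ is the distribution function of the beta$(\alpha,\beta)$ distribution, that is, $I_x(\alpha,\beta)=\int_0^x u^{\alpha-1}(1-u)^{\beta-1}du\Big/\int_0^1 u^{\alpha-1}(1-u)^{\beta-1}du$ for $0\le x\le 1$ and $I_x(\alpha,\beta)=0$ for $x<0$. -/

import Mathlib

open MeasureTheory ProbabilityTheory

namespace TypeICensoring

/-- The costs of the quadratic loss: `Cs` per item inspected, `rs` salvage value of a surviving item,
`Ct` per unit of time, `Cr` for rejecting the batch, and `a0 + a1 * lam + a2 * lam ^ 2` for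
accepting it. -/
structure Costs where
  Cs : ℝ
  rs : ℝ
  Ct : ℝ
  Cr : ℝ
  a0 : ℝ
  a1 : ℝ
  a2 : ℝ

/-- The two decisions: accept the batch (`d0`) or reject it (`d1`). -/
inductive Action where
  | d0
  | d1

/-- The `i`-th smallest lifetime (the index `i` starts from `0`). -/
noncomputable def orderStat {n : ℕ} (x : Fin n → ℝ) (i : Fin n) : ℝ :=
  x (Tuple.sort x i)

/-- `M`, the number of failures observed up to the censoring time `τ`. -/
noncomputable def numFailures {n : ℕ} (τ : ℝ) (x : Fin n → ℝ) : ℕ :=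
  (Finset.univ.filter fun i : Fin n => x i ≤ τ).card

/-- `X_(1) + ... + X_(M) + (n - M) τ`, the total time on test. -/
noncomputable def totalTime {n : ℕ} (τ : ℝ) (x : Fin n → ℝ) : ℝ :=
  (∑ i : Fin n, if (i : ℕ) < numFailures τ x then orderStat x i else 0)
    + ((n : ℝ) - (numFailures τ x : ℝ)) * τ

/-- The estimator of the failure rate: `0` if there is no failure, and otherwise the maximum
likelihood estimator, the number of failures over the total time on test. -/
noncomputable def rateEstimator {n : ℕ} (τ : ℝ) (x : Fin n → ℝ) : ℝ :=
  if numFailures τ x = 0 then 0 else (numFailures τ x : ℝ) / totalTime τ x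

/-- The decision function: reject if and only if the estimator is at least `ζ`. -/
noncomputable def decision {n : ℕ} (τ ζ : ℝ) (x : Fin n → ℝ) : Action :=
  if rateEstimator τ x < ζ then Action.d0 else Action.d1

/-- The quadratic loss of an action when the failure rate is `lam` and the lifetimes are `x`. -/
noncomputable def loss (c : Costs) {n : ℕ} (τ lam : ℝ) (x : Fin n → ℝ) : Action → ℝ
  | Action.d0 => n * c.Cs - ((n : ℝ) - (numFailures τ x : ℝ)) * c.rs + τ * c.Ct
      + c.a0 + c.a1 * lam + c.a2 * lam ^ 2
  | Action.d1 => n * c.Cs - ((n : ℝ) - (numFailures τ x : ℝ)) * c.rs + τ * c.Ct + c.Cr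

/-- The joint law of `n` independent exponential lifetimes with rate `lam`. -/
noncomputable def lifetimes (n : ℕ) (lam : ℝ) : Measure (Fin n → ℝ) :=
  Measure.pi fun _ : Fin n => expMeasure lam

/-- The conditional expectation of the loss of the sampling plan `(n, τ, ζ)`, given the rate. -/
noncomputable def conditionalRisk (c : Costs) (n : ℕ) (τ ζ lam : ℝ) : ℝ :=
  ∫ x : Fin n → ℝ, loss c τ lam x (decision τ ζ x) ∂(lifetimes n lam)

/-- The Bayes risk of the sampling plan `(n, τ, ζ)` for the gamma prior with shape `a`, rate `b`. -/
noncomputable def bayesRisk (c : Costs) (a b : ℝ) (n : ℕ) (τ ζ : ℝ) : ℝ :=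
  ∫ lam, conditionalRisk c n τ ζ lam ∂(gammaMeasure a b)

/-- The conditional expectation of `M`, given the rate. -/
noncomputable def conditionalFailures (n : ℕ) (τ lam : ℝ) : ℝ :=
  ∫ x : Fin n → ℝ, (numFailures τ x : ℝ) ∂(lifetimes n lam)

/-- `E(M)`, the prior expectation of the number of failures. -/
noncomputable def expectedFailures (a b : ℝ) (n : ℕ) (τ : ℝ) : ℝ :=
  ∫ lam, conditionalFailures n τ lam ∂(gammaMeasure a b)

/-- The prior moment `μ_i = E(lam ^ i)`. -/
noncomputable def priorMoment (a b : ℝ) (i : ℕ) : ℝ :=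
  ∫ lam, lam ^ i ∂(gammaMeasure a b)

/-- The coefficients `Cr - a0`, `-a1`, `-a2`. -/
def coeffC (c : Costs) : Fin 3 → ℝ :=
  ![c.Cr - c.a0, -c.a1, -c.a2]

/-- The incomplete beta function `B_x(α, β)`, for `0 ≤ x ≤ 1`. -/
noncomputable def incBeta (x α β : ℝ) : ℝ :=
  ∫ u in (0 : ℝ)..x, u ^ (α - 1) * (1 - u) ^ (β - 1)

/-- The distribution function `I_x(α, β)` of the beta distribution, for `x ≤ 1`: it is the
regularized incomplete beta function on `[0, 1]`, and `0` for negative `x`. -/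
noncomputable def regIncBeta (x α β : ℝ) : ℝ :=
  if x < 0 then 0 else incBeta x α β / incBeta 1 α β

/-- `τ_{j,m} = (n - m + j) τ / m`. -/
noncomputable def tauJM (n : ℕ) (τ : ℝ) (j m : ℕ) : ℝ :=
  ((n : ℝ) - m + j) * (τ / m)

/-- `C_{j,m} = b + m τ_{j,m}`. -/
noncomputable def CJM (b : ℝ) (n : ℕ) (τ : ℝ) (j m : ℕ) : ℝ :=
  b + m * tauJM n τ j m

/-- `C*_{j,m} = m (1 / ζ - τ_{j,m}) / C_{j,m}`, for `ζ > 0`. -/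
noncomputable def CstarJM (b : ℝ) (n : ℕ) (τ ζ : ℝ) (j m : ℕ) : ℝ :=
  m * (1 / ζ - tauJM n τ j m) / CJM b n τ j m

/-- `S*_{j,m} = C*_{j,m} / (1 + C*_{j,m})`; for `ζ = 0`, where `1 / ζ` and `C*_{j,m}` are infinite,
this is `1`. -/
noncomputable def SstarJM (b : ℝ) (n : ℕ) (τ ζ : ℝ) (j m : ℕ) : ℝ :=
  if ζ = 0 then 1 else CstarJM b n τ ζ j m / (1 + CstarJM b n τ ζ j m)

end TypeICensoring

namespace TypeICensoring

/-! ### Observed failures and total time on test -/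

/-! Given the rate `lam`, the loss depends on the lifetimes only through the number of failures `M`
and the total time on test `T = ∑ min(X_i, τ)`, so the core is the joint law of `(M, T)`. Let an
item act on bounded functions `F(m, y)` of a counter and a clock by averaging `F(m + 1{X ≤ τ}, y +
min(X, τ))`. Let `A` shift the clock by `τ` with weight `exp(-lam τ)`, and let `B` raise the counter
and advance the clock by an exponential time. Lack of memory turns the integral of `F(m + 1, y + X)`
over `X > τ` into `A B F`, so the item acts as `A + (1 - A) B` (`itemOp_apply`). Since `A` and `B`
commute, the `n`-th power expands by the binomial theorem into the terms `(-1)^j C(n,m) C(m,j)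
A^(n-m+j) B^m`, where `B^m` adds a gamma variable of shape `m`. Hence the law of `(M, T)` is an
alternating mixture of shifted gamma laws (`integral_lifetimes`). Almost surely the loss is affine
in `M` and in the indicator of rejection, with coefficients polynomial in `lam` (`loss_decision`).
It remains to integrate `lam^l exp(-lam t)`, alone or times a gamma distribution function, over the
prior. Alone it gives a gamma factor; with the distribution function, Fubini and the substitution `u
= x / (C + x)` give the incomplete beta function (`integral_gamma_mul_gamma_cdf`). -/

theorem numFailures_le {n : ℕ} (τ : ℝ) (x : Fin n → ℝ) : numFailures τ x ≤ n := by
  simpa [numFailures] using Finset.card_filter_le (Finset.univ : Finset (Fin n)) (fun i => x i ≤ τ)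

/-- Sorting permutes the lifetimes and so preserves the count; in a monotone sequence the entries `≤
τ` form an initial segment. -/
theorem lt_numFailures_iff {n : ℕ} (τ : ℝ) (x : Fin n → ℝ) (i : Fin n) :
    (i : ℕ) < numFailures τ x ↔ orderStat x i ≤ τ := by
  have hcard : numFailures τ x
      = (Finset.univ.filter fun i : Fin n => (x ∘ Tuple.sort x) i ≤ τ).card := by
    simp only [numFailures, Finset.card_filter]
    exact (Equiv.sum_comp (Tuple.sort x) fun i => if x i ≤ τ then 1 else 0).symm
  rw [hcard]
  exact Tuple.lt_card_le_iff_apply_le_of_monotone (Tuple.monotone_sort x)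

/-- The total time on test is the sum of the lifetimes truncated at the censoring time. -/
theorem totalTime_eq_sum_min {n : ℕ} (τ : ℝ) (x : Fin n → ℝ) :
    totalTime τ x = ∑ i, min (x i) τ := by
  have h1 : (∑ i : Fin n, if (i : ℕ) < numFailures τ x then orderStat x i else 0)
      = ∑ i, if x i ≤ τ then x i else 0 := by
    simp only [lt_numFailures_iff]
    exact Equiv.sum_comp (Tuple.sort x) fun i => if x i ≤ τ then x i else 0
  have h2 : (numFailures τ x : ℝ) = ∑ i, if x i ≤ τ then 1 else 0 := by
    simp [numFailures]
  have h3 : (n : ℝ) = ∑ _i : Fin n, (1 : ℝ) := by simp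
  rw [totalTime, h1, h2, h3, ← Finset.sum_sub_distrib, Finset.sum_mul, ← Finset.sum_add_distrib]
  refine Finset.sum_congr rfl fun i _ => ?_
  split_ifs with h
  · simp [h]
  · simp [min_eq_right (not_le.1 h).le]

theorem numFailures_cons {n : ℕ} (τ y : ℝ) (x : Fin n → ℝ) :
    numFailures τ (Fin.cons y x : Fin (n + 1) → ℝ)
      = (if y ≤ τ then 1 else 0) + numFailures τ x := by
  simp only [numFailures, Finset.card_filter, Fin.sum_univ_succ, Fin.cons_zero, Fin.cons_succ]

theorem totalTime_cons {n : ℕ} (τ y : ℝ) (x : Fin n → ℝ) :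
    totalTime τ (Fin.cons y x : Fin (n + 1) → ℝ) = min y τ + totalTime τ x := by
  simp only [totalTime_eq_sum_min, Fin.sum_univ_succ, Fin.cons_zero, Fin.cons_succ]

theorem measurable_numFailures (n : ℕ) (τ : ℝ) :
    Measurable (numFailures τ : (Fin n → ℝ) → ℕ) := by
  have : (numFailures τ : (Fin n → ℝ) → ℕ) = fun x => ∑ i, if x i ≤ τ then 1 else 0 := by
    funext x
    simp [numFailures]
  rw [this]
  exact Finset.measurable_fun_sum _ fun i _ => Measurable.ite
    (measurableSet_le (measurable_pi_apply i) measurable_const) measurable_const measurable_const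

theorem measurable_totalTime (n : ℕ) (τ : ℝ) :
    Measurable (totalTime τ : (Fin n → ℝ) → ℝ) := by
  have : (totalTime τ : (Fin n → ℝ) → ℝ) = fun x => ∑ i, min (x i) τ := by
    funext x
    exact totalTime_eq_sum_min τ x
  rw [this]
  fun_prop

/-! ### Gamma and exponential laws -/

theorem measurable_gammaPDF (a r : ℝ) : Measurable (gammaPDF a r) :=
  (measurable_gammaPDFReal a r).ennreal_ofReal

theorem integral_gammaMeasure {a r : ℝ} (ha : 0 < a) (hr : 0 < r) (f : ℝ → ℝ) :
    ∫ x, f x ∂(gammaMeasure a r)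
      = ∫ x in Set.Ioi 0, r ^ a / Real.Gamma a * x ^ (a - 1) * Real.exp (-(r * x)) * f x := by
  have hm := measurable_gammaPDF a r
  rw [gammaMeasure, integral_withDensity_eq_integral_toReal_smul hm
    (Filter.Eventually.of_forall fun x => ENNReal.ofReal_lt_top),
    ← integral_Ici_eq_integral_Ioi, ← integral_indicator measurableSet_Ici]
  congr 1
  funext x
  rw [gammaPDF, ENNReal.toReal_ofReal (gammaPDFReal_nonneg ha hr x), gammaPDFReal]
  by_cases hx : 0 ≤ x
  · simp [hx]
  · simp [hx]

theorem integrable_gammaMeasure_iff {a r : ℝ} (ha : 0 < a) (hr : 0 < r) (f : ℝ → ℝ) :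
    Integrable f (gammaMeasure a r) ↔ IntegrableOn
      (fun x => r ^ a / Real.Gamma a * x ^ (a - 1) * Real.exp (-(r * x)) * f x) (Set.Ioi 0) := by
  have hm := measurable_gammaPDF a r
  rw [gammaMeasure, integrable_withDensity_iff_integrable_smul' hm
    (Filter.Eventually.of_forall fun x => ENNReal.ofReal_lt_top),
    ← integrableOn_Ici_iff_integrableOn_Ioi, ← integrable_indicator_iff measurableSet_Ici]
  refine iff_of_eq (congrArg (fun g => Integrable g volume) ?_)
  funext x
  rw [gammaPDF, ENNReal.toReal_ofReal (gammaPDFReal_nonneg ha hr x), gammaPDFReal]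
  by_cases hx : 0 ≤ x
  · simp [hx]
  · simp [hx]

theorem ae_pos_gammaMeasure (a r : ℝ) : ∀ᵐ x ∂(gammaMeasure a r), 0 < x := by
  -- The density need not vanish at `0` (for `a = 1` it is `r`), so the origin is discarded as a
  -- Lebesgue null set.
  have h : ∀ᵐ x ∂(volume : Measure ℝ), x ≠ 0 := by simp [ae_iff, measure_singleton]
  rw [gammaMeasure, ae_withDensity_iff (measurable_gammaPDF a r)]
  filter_upwards [h] with x hx hne
  by_contra hcon
  exact hne (gammaPDF_of_neg (lt_of_le_of_ne (not_lt.1 hcon) hx))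

theorem integral_expMeasure {r : ℝ} (hr : 0 < r) (f : ℝ → ℝ) :
    ∫ x, f x ∂(expMeasure r) = ∫ x in Set.Ioi 0, r * Real.exp (-(r * x)) * f x := by
  rw [expMeasure, integral_gammaMeasure one_pos hr]
  simp

theorem integrable_of_bounded {α : Type*} [MeasurableSpace α] {μ : Measure α} [IsFiniteMeasure μ]
    {f : α → ℝ} (hf : Measurable f) {K : ℝ} (hK : ∀ x, |f x| ≤ K) : Integrable f μ :=
  Integrable.of_bound hf.aestronglyMeasurable K (Filter.Eventually.of_forall hK)

/-- Lack of memory of the exponential law. -/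
theorem setIntegral_Ioi_expMeasure {r τ : ℝ} (hr : 0 < r) (hτ : 0 ≤ τ) (f : ℝ → ℝ) :
    ∫ x in Set.Ioi τ, f x ∂(expMeasure r)
      = Real.exp (-(r * τ)) * ∫ x, f (x + τ) ∂(expMeasure r) := by
  rw [← integral_indicator measurableSet_Ioi, integral_expMeasure hr, integral_expMeasure hr,
    ← integral_const_mul]
  have h1 : ∀ x, r * Real.exp (-(r * x)) * (Set.Ioi τ).indicator f x
      = (Set.Ioi τ).indicator (fun x => r * Real.exp (-(r * x)) * f x) x := by
    intro x
    by_cases hx : x ∈ Set.Ioi τ <;> simp [hx]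
  simp_rw [h1]
  rw [setIntegral_indicator measurableSet_Ioi, Set.inter_eq_right.2 (Set.Ioi_subset_Ioi hτ),
    ← integral_indicator measurableSet_Ioi, ← integral_indicator measurableSet_Ioi,
    ← integral_add_right_eq_self _ τ]
  congr 1
  funext x
  by_cases hx : 0 < x
  · rw [Set.indicator_of_mem (by simpa using hx), Set.indicator_of_mem (by simpa using hx),
      show -(r * (x + τ)) = -(r * τ) + -(r * x) by ring, Real.exp_add]
    ring
  · rw [Set.indicator_of_notMem (by simpa using hx), Set.indicator_of_notMem (by simpa using hx)]

/-- The part over `x ≤ τ` is the whole integral minus the tail, and lack of memory makes the tail a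
shifted whole integral. No truncated law remains; this subtraction is the origin of the signs
`(-1)^j`. -/
theorem integral_ite_expMeasure {r τ : ℝ} (hr : 0 < r) (hτ : 0 ≤ τ) {f : ℝ → ℝ}
    (hf : Measurable f) {K : ℝ} (hK : ∀ x, |f x| ≤ K) (c : ℝ) :
    ∫ x, (if x ≤ τ then f x else c) ∂(expMeasure r)
      = Real.exp (-(r * τ)) * c + (∫ x, f x ∂(expMeasure r)
          - Real.exp (-(r * τ)) * ∫ x, f (x + τ) ∂(expMeasure r)) := by
  have := isProbabilityMeasure_expMeasure hr
  have hfi : Integrable f (expMeasure r) := integrable_of_bounded hf hK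
  have h1 : ∀ x, (if x ≤ τ then f x else c)
      = (f x - (Set.Ioi τ).indicator f x) + (Set.Ioi τ).indicator (fun _ => c) x := by
    intro x
    by_cases hx : x ≤ τ
    · simp [hx]
    · simp [hx, not_le.1 hx]
  simp_rw [h1]
  have hsub : Integrable (fun x => f x - (Set.Ioi τ).indicator f x) (expMeasure r) :=
    hfi.sub (hfi.indicator measurableSet_Ioi)
  rw [integral_add hsub ((integrable_const c).indicator measurableSet_Ioi),
    integral_sub hfi (hfi.indicator measurableSet_Ioi), integral_indicator measurableSet_Ioi,
    integral_indicator measurableSet_Ioi, setIntegral_Ioi_expMeasure hr hτ,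
    setIntegral_Ioi_expMeasure hr hτ]
  simp
  ring

/-- Adding an independent exponential variable to a gamma variable of integer shape. -/
theorem gammaMeasure_conv_expMeasure {r : ℝ} (hr : 0 < r) {m : ℕ} (hm : 0 < m) :
    gammaMeasure m r ∗ expMeasure r = gammaMeasure (m + 1 : ℕ) r := by
  have hm' : (0 : ℝ) < m := by exact_mod_cast hm
  rw [expMeasure, gammaMeasure, gammaMeasure, gammaMeasure,
    conv_withDensity_eq_lconvolution (measurable_gammaPDF _ _)
      (measurable_gammaPDF _ _)]
  congr 1
  funext w
  rw [lconvolution_def]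
  -- The two exponentials combine to a factor free of `y`, so the convolution reduces to integrating
  -- `y ^ (m - 1)` over `[0, w]`.
  have hpt : ∀ y, gammaPDF m r y * gammaPDF 1 r (-y + w) = (Set.Icc 0 w).indicator
      (fun y => ENNReal.ofReal (r ^ (m + 1) / Real.Gamma m * Real.exp (-(r * w)) * y ^ (m - 1)))
        y := by
    intro y
    by_cases hy : 0 ≤ y
    · by_cases hw : y ≤ w
      · rw [Set.indicator_of_mem (Set.mem_Icc.2 ⟨hy, hw⟩), gammaPDF_of_nonneg hy,
          gammaPDF_of_nonneg (by linarith), ← ENNReal.ofReal_mul (by positivity)]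
        congr 1
        rw [show ((m : ℝ) - 1) = ((m - 1 : ℕ) : ℝ) by rw [Nat.cast_sub hm]; simp,
          Real.rpow_natCast, Real.rpow_natCast,
          show -(r * w) = -(r * y) + -(r * (-y + w)) by ring, Real.exp_add, pow_succ]
        simp
        ring
      · rw [Set.indicator_of_notMem (fun h => hw h.2), gammaPDF_of_neg (x := -y + w) (by linarith),
          mul_zero]
    · rw [Set.indicator_of_notMem (fun h => hy h.1), gammaPDF_of_neg (not_le.1 hy), zero_mul]
  simp_rw [hpt]
  rw [lintegral_indicator measurableSet_Icc]
  by_cases hw : 0 ≤ w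
  · rw [gammaPDF_of_nonneg hw, ← ofReal_integral_eq_lintegral_ofReal]
    · congr 1
      rw [integral_Icc_eq_integral_Ioc, ← intervalIntegral.integral_of_le hw,
        intervalIntegral.integral_const_mul, integral_pow]
      have hmm : m - 1 + 1 = m := Nat.sub_add_cancel hm
      rw [show ((m - 1 : ℕ) : ℝ) + 1 = m by exact_mod_cast hmm, hmm]
      push_cast
      rw [Real.Gamma_add_one hm'.ne', add_sub_cancel_right, Real.rpow_natCast,
        show ((m : ℝ) + 1) = ((m + 1 : ℕ) : ℝ) by push_cast; rfl, Real.rpow_natCast,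
        zero_pow hm.ne', sub_zero]
      have := (Real.Gamma_pos_of_pos hm').ne'
      field_simp
    · exact (Continuous.continuousOn (by fun_prop)).integrableOn_Icc
    · refine (ae_restrict_iff' measurableSet_Icc).2 (Filter.Eventually.of_forall fun y hy => ?_)
      have h0 : 0 ≤ y := hy.1
      have := Real.Gamma_pos_of_pos hm'
      simp only [Pi.zero_apply]
      positivity
  · rw [Set.Icc_eq_empty hw, gammaPDF_of_neg (not_le.1 hw)]
    simp

/-! ### The joint law of the number of failures and the total time on test -/

/-- Two binomial expansions: `m` counts the factors contributing `(1 - a) * b`, and `j` the factors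
`-a` chosen from `(1 - a) ^ m`. Writing `1 + (-1) • a` avoids subtraction in the semiring. -/
theorem add_one_sub_mul_pow {R : Type*} [Semiring R] [Algebra ℝ R] {a b : R} (hc : Commute a b)
    (n : ℕ) :
    (a + (1 + (-1 : ℝ) • a) * b) ^ n = ∑ m ∈ Finset.range (n + 1), ∑ j ∈ Finset.range (m + 1),
      ((-1 : ℝ) ^ j * n.choose m * m.choose j) • (a ^ (n - m + j) * b ^ m) := by
  have hc1 : Commute (1 + (-1 : ℝ) • a) b := (Commute.one_left _).add_left (hc.smul_left _)
  have hc2 : Commute ((1 + (-1 : ℝ) • a) * b) a :=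
    ((Commute.one_left _).add_left ((Commute.refl _).smul_left _)).mul_left hc.symm
  rw [add_comm, hc2.add_pow]
  refine Finset.sum_congr rfl fun m _ => ?_
  have hbin : (1 + (-1 : ℝ) • a) ^ m
      = ∑ j ∈ Finset.range (m + 1), ((-1 : ℝ) ^ j * m.choose j) • a ^ j := by
    rw [add_comm, (Commute.one_right _).add_pow]
    refine Finset.sum_congr rfl fun j _ => ?_
    rw [one_pow, mul_one, smul_pow, ← nsmul_eq_mul', mul_comm, mul_smul, Nat.cast_smul_eq_nsmul]
  rw [hc1.mul_pow, hbin, Finset.sum_mul, Finset.sum_mul, Finset.sum_mul]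
  refine Finset.sum_congr rfl fun j _ => ?_
  have hab : a ^ j * b ^ m * a ^ (n - m) = a ^ (n - m + j) * b ^ m := by
    rw [mul_assoc, (hc.symm.pow_pow m (n - m)).eq, ← mul_assoc, ← pow_add, add_comm j]
  rw [smul_mul_assoc, smul_mul_assoc, smul_mul_assoc, hab, ← nsmul_eq_mul' _ (n.choose m),
    ← Nat.cast_smul_eq_nsmul ℝ (n.choose m), smul_smul]
  congr 1
  ring

/-- Bounded measurable functions of a counter and a time. -/
def boundedFun : Submodule ℝ (ℕ → ℝ → ℝ) where
  carrier := {F | (∀ m, Measurable (F m)) ∧ ∃ K, ∀ m y, |F m y| ≤ K}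
  zero_mem' := ⟨fun _ => measurable_const, 0, by simp⟩
  add_mem' := by
    rintro F G ⟨hF, K, hK⟩ ⟨hG, L, hL⟩
    exact ⟨fun m => (hF m).add (hG m), K + L, fun m y =>
      (abs_add_le _ _).trans (add_le_add (hK m y) (hL m y))⟩
  smul_mem' := by
    rintro c F ⟨hF, K, hK⟩
    refine ⟨fun m => (hF m).const_mul c, |c| * K, fun m y => ?_⟩
    simp only [Pi.smul_apply, smul_eq_mul, abs_mul]
    exact mul_le_mul_of_nonneg_left (hK m y) (abs_nonneg c)

/-- The space of bounded measurable functions of a counter and a time. -/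
abbrev BoundedFun : Type := boundedFun

theorem BoundedFun.measurable (F : BoundedFun) (m : ℕ) : Measurable (F.1 m) := F.2.1 m

theorem BoundedFun.exists_bound (F : BoundedFun) : ∃ K, ∀ m y, |F.1 m y| ≤ K := F.2.2

theorem BoundedFun.measurable_comp {α : Type*} [MeasurableSpace α] (F : BoundedFun)
    {M : α → ℕ} {T : α → ℝ} (hM : Measurable M) (hT : Measurable T) :
    Measurable fun x => F.1 (M x) (T x) := by
  have h : Measurable (Function.uncurry F.1) := measurable_from_prod_countable_right F.measurable
  exact h.comp (hM.prodMk hT)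

theorem BoundedFun.integrable_comp {α : Type*} [MeasurableSpace α] {μ : Measure α}
    [IsFiniteMeasure μ] (F : BoundedFun) {M : α → ℕ} {T : α → ℝ} (hM : Measurable M)
    (hT : Measurable T) : Integrable (fun x => F.1 (M x) (T x)) μ := by
  obtain ⟨K, hK⟩ := F.exists_bound
  exact integrable_of_bounded (F.measurable_comp hM hT) fun x => hK _ _

theorem BoundedFun.integrable_add {μ : Measure ℝ} [IsFiniteMeasure μ] (F : BoundedFun) (m : ℕ)
    (y : ℝ) : Integrable (fun x => F.1 m (y + x)) μ :=
  F.integrable_comp measurable_const (measurable_const_add y)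

/-- One censored item: the clock advances by `τ`, with the probability of survival as weight. -/
noncomputable def censorOp (r τ : ℝ) : Module.End ℝ BoundedFun where
  toFun F := ⟨fun m y => Real.exp (-(r * τ)) * F.1 m (y + τ), by
    obtain ⟨K, hK⟩ := F.exists_bound
    refine ⟨fun m => ((F.measurable m).comp (measurable_add_const τ)).const_mul _,
      Real.exp (-(r * τ)) * K, fun m y => ?_⟩
    rw [abs_mul, Real.abs_exp]
    exact mul_le_mul_of_nonneg_left (hK m _) (Real.exp_pos _).le⟩
  map_add' F G := Subtype.ext <| by
    funext m y
    simp [mul_add]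
  map_smul' c F := Subtype.ext <| by
    funext m y
    simp [mul_left_comm]

/-- One uncensored item: the counter increases and the clock advances by an exponential time. -/
noncomputable def failOp {r : ℝ} (hr : 0 < r) : Module.End ℝ BoundedFun where
  toFun F := ⟨fun m y => ∫ x, F.1 (m + 1) (y + x) ∂(expMeasure r), by
    have := isProbabilityMeasure_expMeasure hr
    obtain ⟨K, hK⟩ := F.exists_bound
    refine ⟨fun m => ?_, K, fun m y => ?_⟩
    · have h : StronglyMeasurable (Function.uncurry fun y x => F.1 (m + 1) (y + x)) :=
        (F.measurable_comp measurable_const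
          (measurable_fst.add measurable_snd)).stronglyMeasurable
      exact h.integral_prod_right.measurable
    · simpa using norm_integral_le_of_norm_le_const (μ := expMeasure r)
        (Filter.Eventually.of_forall fun x => (Real.norm_eq_abs _).trans_le (hK (m + 1) (y + x)))⟩
  map_add' F G := Subtype.ext <| by
    have := isProbabilityMeasure_expMeasure hr
    funext m y
    exact integral_add (F.integrable_add _ _) (G.integrable_add _ _)
  map_smul' c F := Subtype.ext <| by
    funext m y
    exact integral_const_mul c _

theorem censorOp_apply (r τ : ℝ) (F : BoundedFun) (m : ℕ) (y : ℝ) :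
    (censorOp r τ F).1 m y = Real.exp (-(r * τ)) * F.1 m (y + τ) := rfl

theorem failOp_apply {r : ℝ} (hr : 0 < r) (F : BoundedFun) (m : ℕ) (y : ℝ) :
    (failOp hr F).1 m y = ∫ x, F.1 (m + 1) (y + x) ∂(expMeasure r) := rfl

/-- Both operators translate the clock, by a fixed and by a random amount, and only `failOp` touches
the counter. -/
theorem commute_censorOp_failOp {r : ℝ} (hr : 0 < r) (τ : ℝ) :
    Commute (censorOp r τ) (failOp hr) := by
  refine LinearMap.ext fun F => Subtype.ext ?_
  funext m y
  simp only [Module.End.mul_apply, censorOp_apply, failOp_apply, integral_const_mul,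
    add_right_comm]

theorem censorOp_pow_apply (r τ : ℝ) (k : ℕ) (F : BoundedFun) (m : ℕ) (y : ℝ) :
    ((censorOp r τ ^ k) F).1 m y = Real.exp (-(r * (k * τ))) * F.1 m (y + k * τ) := by
  induction k generalizing y with
  | zero => simp
  | succ k ih =>
    rw [pow_succ', Module.End.mul_apply, censorOp_apply, ih, ← mul_assoc, ← Real.exp_add]
    push_cast
    ring_nf

/-- The law of a sum of `m` independent exponential variables. -/
noncomputable def erlang (m : ℕ) (r : ℝ) : Measure ℝ :=
  -- An empty sum is the point mass at `0`, whereas `gammaMeasure 0 r` is the zero measure because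
  -- `Real.Gamma 0 = 0`.
  if m = 0 then Measure.dirac 0 else gammaMeasure m r

theorem isProbabilityMeasure_erlang (m : ℕ) {r : ℝ} (hr : 0 < r) :
    IsProbabilityMeasure (erlang m r) := by
  unfold erlang
  split_ifs with h
  · infer_instance
  · exact isProbabilityMeasure_gammaMeasure (by exact_mod_cast Nat.pos_of_ne_zero h) hr

theorem erlang_conv_expMeasure {r : ℝ} (hr : 0 < r) (m : ℕ) :
    erlang m r ∗ expMeasure r = erlang (m + 1) r := by
  have := isProbabilityMeasure_expMeasure hr
  rcases Nat.eq_zero_or_pos m with rfl | hm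
  · have := isProbabilityMeasure_gammaMeasure one_pos hr
    simp [erlang, expMeasure]
  · simpa [erlang, hm.ne'] using gammaMeasure_conv_expMeasure hr hm

theorem failOp_pow_apply {r : ℝ} (hr : 0 < r) (k : ℕ) (F : BoundedFun) (m : ℕ) (y : ℝ) :
    ((failOp hr ^ k) F).1 m y = ∫ x, F.1 (m + k) (y + x) ∂(erlang k r) := by
  have := isProbabilityMeasure_expMeasure hr
  induction k generalizing m y F with
  | zero => simp [erlang]
  | succ k ih =>
    have := isProbabilityMeasure_erlang k hr
    have := isProbabilityMeasure_erlang (k + 1) hr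
    rw [pow_succ, Module.End.mul_apply, ih, ← erlang_conv_expMeasure hr, integral_conv]
    · simp only [failOp_apply, add_assoc]
    · rw [erlang_conv_expMeasure hr]
      exact F.integrable_add _ _

/-- The effect of a single item on test. -/
noncomputable def itemOp {r : ℝ} (hr : 0 < r) (τ : ℝ) : Module.End ℝ BoundedFun :=
  censorOp r τ + (1 + (-1 : ℝ) • censorOp r τ) * failOp hr

/-- The summand `censorOp` is survival past `τ`. Failure before `τ` contributes the full expectation
`failOp` minus its tail `censorOp * failOp`, by `integral_ite_expMeasure`. -/
theorem itemOp_apply {r τ : ℝ} (hr : 0 < r) (hτ : 0 ≤ τ) (F : BoundedFun) (m : ℕ) (y : ℝ) :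
    (itemOp hr τ F).1 m y
      = ∫ x, F.1 (m + if x ≤ τ then 1 else 0) (y + min x τ) ∂(expMeasure r) := by
  obtain ⟨K, hK⟩ := F.exists_bound
  have h : ∀ x, F.1 (m + if x ≤ τ then 1 else 0) (y + min x τ)
      = if x ≤ τ then F.1 (m + 1) (y + x) else F.1 m (y + τ) := by
    intro x
    split_ifs with hx
    · rw [min_eq_left hx]
    · rw [min_eq_right (not_le.1 hx).le, add_zero]
  simp_rw [h]
  rw [integral_ite_expMeasure hr hτ (f := fun x => F.1 (m + 1) (y + x))
    ((F.measurable _).comp (measurable_const_add y)) (fun x => hK _ _)]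
  simp only [itemOp, LinearMap.add_apply, LinearMap.smul_apply, Module.End.mul_apply,
    Module.End.one_apply, Submodule.coe_add, Submodule.coe_smul, Pi.add_apply, Pi.smul_apply,
    smul_eq_mul, neg_one_mul, ← sub_eq_add_neg, censorOp_apply, failOp_apply]
  simp only [add_assoc, add_comm τ]

theorem isProbabilityMeasure_lifetimes (n : ℕ) {r : ℝ} (hr : 0 < r) :
    IsProbabilityMeasure (lifetimes n r) := by
  have := isProbabilityMeasure_expMeasure hr
  unfold lifetimes
  infer_instance

/-- Independence lets the items act one at a time, by Fubini. The starting state `(m, y)` is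
arbitrary because each item moves it before the induction hypothesis is applied to the others. -/
theorem integral_lifetimes_eq_itemOp_pow {r τ : ℝ} (hr : 0 < r) (hτ : 0 ≤ τ) (n : ℕ)
    (F : BoundedFun) (m : ℕ) (y : ℝ) :
    ∫ x : Fin n → ℝ, F.1 (m + numFailures τ x) (y + totalTime τ x) ∂(lifetimes n r)
      = ((itemOp hr τ ^ n) F).1 m y := by
  have := isProbabilityMeasure_expMeasure hr
  induction n generalizing m y with
  | zero =>
    have := isProbabilityMeasure_lifetimes 0 hr
    have h : ∀ x : Fin 0 → ℝ, F.1 (m + numFailures τ x) (y + totalTime τ x) = F.1 m y := by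
      intro x
      simp [numFailures, totalTime]
    simp [h]
  | succ n ih =>
    have := isProbabilityMeasure_lifetimes n hr
    have hmp := measurePreserving_piFinSuccAbove (fun _ : Fin (n + 1) => expMeasure r) 0
    rw [lifetimes, ← (hmp.symm _).integral_comp (MeasurableEquiv.measurableEmbedding _)]
    have h : ∀ z : ℝ × (Fin n → ℝ),
        (MeasurableEquiv.piFinSuccAbove (fun _ : Fin (n + 1) => ℝ) 0).symm z
          = Fin.cons z.1 z.2 := by
      intro z
      simp [MeasurableEquiv.piFinSuccAbove, Fin.insertNthEquiv]
    simp_rw [h, numFailures_cons, totalTime_cons, ← add_assoc]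
    have hint : Integrable (fun z : ℝ × (Fin n → ℝ) =>
        F.1 (m + (if z.1 ≤ τ then 1 else 0) + numFailures τ z.2)
          (y + min z.1 τ + totalTime τ z.2)) ((expMeasure r).prod (lifetimes n r)) := by
      refine F.integrable_comp ?_ ?_
      · refine (Measurable.const_add (Measurable.ite (measurableSet_le measurable_fst
          measurable_const) measurable_const measurable_const) m).add
            ((measurable_numFailures n τ).comp measurable_snd)
      · exact ((measurable_fst.min measurable_const).const_add y).add
          ((measurable_totalTime n τ).comp measurable_snd)
    rw [pow_succ', Module.End.mul_apply, itemOp_apply hr hτ]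
    exact (integral_prod _ hint).trans
      (integral_congr_ae (Filter.Eventually.of_forall fun x =>
        ih (m + if x ≤ τ then 1 else 0) (y + min x τ)))

theorem itemOp_pow {r : ℝ} (hr : 0 < r) (τ : ℝ) (n : ℕ) :
    itemOp hr τ ^ n = ∑ m ∈ Finset.range (n + 1), ∑ j ∈ Finset.range (m + 1),
      ((-1 : ℝ) ^ j * n.choose m * m.choose j) •
        (censorOp r τ ^ (n - m + j) * failOp hr ^ m) :=
  add_one_sub_mul_pow (commute_censorOp_failOp hr τ) n

/-- The joint law of the number of failures and the total time on test, as an alternating mixture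
of shifted gamma laws. -/
theorem integral_lifetimes {r τ : ℝ} (hr : 0 < r) (hτ : 0 ≤ τ) (n : ℕ) (F : BoundedFun) :
    ∫ x : Fin n → ℝ, F.1 (numFailures τ x) (totalTime τ x) ∂(lifetimes n r)
      = ∑ m ∈ Finset.range (n + 1), ∑ j ∈ Finset.range (m + 1),
        ((-1 : ℝ) ^ j * n.choose m * m.choose j) *
          (Real.exp (-(r * ((n - m + j : ℕ) * τ)))
            * ∫ x, F.1 m ((n - m + j : ℕ) * τ + x) ∂(erlang m r)) := by
  have h := integral_lifetimes_eq_itemOp_pow hr hτ n F 0 0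
  simp only [zero_add] at h
  rw [h, itemOp_pow]
  simp only [LinearMap.sum_apply, LinearMap.smul_apply, Module.End.mul_apply,
    Submodule.coe_sum, Finset.sum_apply, Submodule.coe_smul, Pi.smul_apply, smul_eq_mul,
    censorOp_pow_apply, failOp_pow_apply, zero_add]

/-! ### Mixing over the gamma prior -/

theorem integrableOn_rpow_mul_exp_neg_mul {a r : ℝ} (ha : 0 < a) (hr : 0 < r) :
    IntegrableOn (fun x : ℝ => x ^ (a - 1) * Real.exp (-(r * x))) (Set.Ioi 0) := by
  have h := integrableOn_rpow_mul_exp_neg_mul_rpow (p := 1) (s := a - 1) (by linarith) one_pos hr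
  simpa using h

/-- The factor `x ^ l * exp (-(x * t))` is absorbed by the gamma kernel, whose shape becomes `a + l`
and whose rate becomes `b + t`. -/
theorem gamma_density_mul_pow_mul_exp {a b : ℝ} (l : ℕ) (t : ℝ) {x : ℝ} (hx : 0 < x) :
    b ^ a / Real.Gamma a * x ^ (a - 1) * Real.exp (-(b * x)) * (x ^ l * Real.exp (-(x * t)))
      = b ^ a / Real.Gamma a * (x ^ (a + l - 1) * Real.exp (-((b + t) * x))) := by
  rw [show a + l - 1 = (a - 1) + (l : ℝ) by ring, Real.rpow_add hx, Real.rpow_natCast,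
    show -((b + t) * x) = -(b * x) + -(x * t) by ring, Real.exp_add]
  ring

theorem integrable_pow_mul_exp {a b t : ℝ} (ha : 0 < a) (hb : 0 < b) (ht : 0 ≤ t) (l : ℕ) :
    Integrable (fun lam => lam ^ l * Real.exp (-(lam * t))) (gammaMeasure a b) := by
  rw [integrable_gammaMeasure_iff ha hb]
  refine IntegrableOn.congr_fun
    ((integrableOn_rpow_mul_exp_neg_mul (a := a + l) (r := b + t) (by positivity)
      (by positivity)).const_mul (b ^ a / Real.Gamma a)) (fun x hx => ?_) measurableSet_Ioi
  exact (gamma_density_mul_pow_mul_exp l t hx).symm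

theorem integral_pow_mul_exp {a b t : ℝ} (ha : 0 < a) (hb : 0 < b) (ht : 0 ≤ t) (l : ℕ) :
    ∫ lam, lam ^ l * Real.exp (-(lam * t)) ∂(gammaMeasure a b)
      = b ^ a / Real.Gamma a * (Real.Gamma (a + l) / (b + t) ^ (a + l)) := by
  rw [integral_gammaMeasure ha hb,
    setIntegral_congr_fun measurableSet_Ioi fun x hx => gamma_density_mul_pow_mul_exp l t hx,
    integral_const_mul, Real.integral_rpow_mul_exp_neg_mul_Ioi (by positivity) (by positivity),
    Real.div_rpow zero_le_one (by positivity), Real.one_rpow]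
  ring

theorem integrable_pow_gammaMeasure {a b : ℝ} (ha : 0 < a) (hb : 0 < b) (l : ℕ) :
    Integrable (fun lam : ℝ => lam ^ l) (gammaMeasure a b) := by
  simpa using integrable_pow_mul_exp ha hb le_rfl l

/-- The measure itself varies with `lam`; for `m > 0`, a density jointly measurable in `(lam, x)`
turns the expression into a parametric Lebesgue integral, valid for almost every `lam`. -/
theorem aestronglyMeasurable_integral_erlang {a b : ℝ} (m : ℕ) {G : ℝ → ℝ} (hG : Measurable G) :
    AEStronglyMeasurable (fun lam => ∫ x, G x ∂(erlang m lam)) (gammaMeasure a b) := by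
  rcases Nat.eq_zero_or_pos m with rfl | hm
  · simpa [erlang] using aestronglyMeasurable_const
  · have hm' : (0 : ℝ) < m := by exact_mod_cast hm
    have h : StronglyMeasurable (Function.uncurry fun lam x : ℝ =>
        lam ^ (m : ℝ) / Real.Gamma m * x ^ ((m : ℝ) - 1) * Real.exp (-(lam * x)) * G x) := by
      refine Measurable.stronglyMeasurable ?_
      simp only [Function.uncurry_def]
      fun_prop
    refine (h.integral_prod_right (ν := volume.restrict (Set.Ioi 0))).aestronglyMeasurable.congr ?_
    filter_upwards [ae_pos_gammaMeasure a b] with lam hlam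
    simp only [erlang, hm.ne', if_false]
    exact (integral_gammaMeasure hm' hlam G).symm

theorem integrable_pow_mul_exp_mul_integral_erlang {a b t : ℝ} (ha : 0 < a) (hb : 0 < b)
    (ht : 0 ≤ t) (l m : ℕ) {G : ℝ → ℝ} (hG : Measurable G) {K : ℝ} (hK : ∀ x, |G x| ≤ K) :
    Integrable (fun lam => lam ^ l * (Real.exp (-(lam * t)) * ∫ x, G x ∂(erlang m lam)))
      (gammaMeasure a b) := by
  simp only [← mul_assoc]
  refine (integrable_pow_mul_exp ha hb ht l).mul_bdd (c := K)
    (aestronglyMeasurable_integral_erlang m hG) ?_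
  filter_upwards [ae_pos_gammaMeasure a b] with lam hlam
  have := isProbabilityMeasure_erlang m hlam
  simpa using norm_integral_le_of_norm_le_const (μ := erlang m lam)
    (Filter.Eventually.of_forall fun x => (Real.norm_eq_abs _).trans_le (hK x))

/-! ### The incomplete beta function -/

theorem incBeta_one {α β : ℝ} (hα : 0 < α) (hβ : 0 < β) :
    incBeta 1 α β = Real.Gamma α * Real.Gamma β / Real.Gamma (α + β) := by
  have h := beta_eq_betaIntegralReal α β hα hβ
  have h2 : Complex.betaIntegral α β = ((incBeta 1 α β : ℝ) : ℂ) := by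
    rw [incBeta, Complex.betaIntegral, ← intervalIntegral.integral_ofReal]
    refine intervalIntegral.integral_congr fun x hx => ?_
    rw [Set.uIcc_of_le zero_le_one] at hx
    have h1 : 0 ≤ 1 - x := by linarith [hx.2]
    push_cast [Complex.ofReal_cpow hx.1, Complex.ofReal_cpow h1]
    rfl
  rw [h2, Complex.ofReal_re] at h
  rw [← h, beta]

/-- Substitution `u = x / (C + x)`, with `1 - u = C / (C + x)` and `du = C / (C + x) ^ 2 dx`. -/
theorem incBeta_eq_integral {m : ℕ} (hm : 0 < m) {C s α : ℝ} (hC : 0 < C) (hs : 0 ≤ s) :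
    incBeta (s / (C + s)) m α
      = C ^ α * ∫ x in (0 : ℝ)..s, x ^ (m - 1) / (C + x) ^ (α + m) := by
  have hpos : ∀ x ∈ Set.uIcc 0 s, 0 < C + x := fun x hx => by
    rw [Set.uIcc_of_le hs] at hx
    linarith [hx.1]
  have hm1 : ((m : ℝ) - 1) = ((m - 1 : ℕ) : ℝ) := by rw [Nat.cast_sub hm]; simp
  have hsub := intervalIntegral.integral_comp_mul_deriv'' (a := 0) (b := s)
    (f := fun x => x / (C + x)) (f' := fun x => C / (C + x) ^ 2)
    (g := fun u => u ^ ((m : ℝ) - 1) * (1 - u) ^ (α - 1)) ?_ ?_ ?_ ?_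
  · rw [incBeta, ← intervalIntegral.integral_const_mul]
    simp only [zero_div] at hsub
    rw [← hsub]
    refine intervalIntegral.integral_congr fun x hx => ?_
    have hx0 := hpos x hx
    have h1 : 1 - x / (C + x) = C / (C + x) := by field_simp; ring
    simp only [Function.comp_apply, h1]
    rw [hm1, Real.rpow_natCast, Real.div_rpow hC.le hx0.le, Real.rpow_sub hC, Real.rpow_one,
      Real.rpow_sub hx0, Real.rpow_one, Real.rpow_add hx0, Real.rpow_natCast, div_pow]
    have h2 : (C + x) ^ m = (C + x) ^ (m - 1) * (C + x) := by
      rw [← pow_succ, Nat.sub_add_cancel hm]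
    rw [h2]
    have := (Real.rpow_pos_of_pos hx0 α).ne'
    field_simp
  · exact continuousOn_id.div (by fun_prop) fun x hx => (hpos x hx).ne'
  · intro x hx
    have hx0 := hpos x (Set.Ioo_subset_Icc_self hx)
    have hd := (hasDerivAt_id x).div ((hasDerivAt_id x).const_add C) hx0.ne'
    exact (hd.congr_deriv (by simp)).hasDerivWithinAt
  · exact continuousOn_const.div (by fun_prop) fun x hx => (pow_pos (hpos x hx) 2).ne'
  · rintro u ⟨x, hx, rfl⟩
    have hx0 := hpos x hx
    have h1 : 0 < 1 - x / (C + x) := by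
      rw [show 1 - x / (C + x) = C / (C + x) by field_simp; ring]
      positivity
    -- Continuity at `u = 0` rests on `m ≥ 1`; since `1 - u` stays positive, the exponent `α - 1`
    -- may be negative.
    have h0 : 0 ≤ (m : ℝ) - 1 := by rw [hm1]; positivity
    exact ((Real.continuousAt_rpow_const _ _ (Or.inr h0)).mul
      (ContinuousAt.rpow_const (by fun_prop) (Or.inl h1.ne'))).continuousWithinAt

/-- Integrating over `lam` before `x` leaves a multiple of `x ^ (m - 1) / (C + x) ^ (α + m)`, the
integrand of `incBeta_eq_integral`; the constant `Γ(α + m) / Γ(m)` matches the normalisation of the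
beta law. -/
theorem integral_gamma_mul_gamma_cdf {m : ℕ} (hm : 0 < m) {C s α : ℝ} (hC : 0 < C) (hs : 0 ≤ s)
    (hα : 0 < α) :
    ∫ lam in Set.Ioi 0, lam ^ (α - 1) * Real.exp (-(C * lam)) *
        ∫ x in Set.Ioc 0 s, lam ^ (m : ℝ) / Real.Gamma m * x ^ ((m : ℝ) - 1) * Real.exp (-(lam * x))
      = Real.Gamma α / C ^ α * regIncBeta (s / (C + s)) m α := by
  have hm' : (0 : ℝ) < m := by exact_mod_cast hm
  have hG := Real.Gamma_pos_of_pos hm'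
  have hm1 : ((m : ℝ) - 1) = ((m - 1 : ℕ) : ℝ) := by rw [Nat.cast_sub hm]; simp
  set f : ℝ → ℝ → ℝ := fun lam x => lam ^ (α - 1) * Real.exp (-(C * lam)) *
    (lam ^ (m : ℝ) / Real.Gamma m * x ^ ((m : ℝ) - 1) * Real.exp (-(lam * x))) with hf
  have hfeq : ∀ x, Set.EqOn (fun lam => f lam x) (fun lam => x ^ (m - 1) / Real.Gamma m *
      (lam ^ (α + m - 1) * Real.exp (-((C + x) * lam)))) (Set.Ioi 0) := by
    intro x lam hlam
    simp only [hf]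
    rw [show α + m - 1 = (α - 1) + m by ring, Real.rpow_add hlam,
      show -((C + x) * lam) = -(C * lam) + -(lam * x) by ring, Real.exp_add, hm1,
      Real.rpow_natCast x]
    ring
  have hfi : ∀ x, 0 < x → IntegrableOn (fun lam => f lam x) (Set.Ioi 0) := fun x hx =>
    IntegrableOn.congr_fun ((integrableOn_rpow_mul_exp_neg_mul (a := α + m) (r := C + x)
      (by positivity) (by positivity)).const_mul _) (hfeq x).symm measurableSet_Ioi
  have hfint : ∀ x, 0 < x → ∫ lam in Set.Ioi 0, f lam x
      = Real.Gamma (α + m) / Real.Gamma m * (x ^ (m - 1) / (C + x) ^ (α + m)) := by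
    intro x hx
    rw [setIntegral_congr_fun measurableSet_Ioi (hfeq x), integral_const_mul,
      Real.integral_rpow_mul_exp_neg_mul_Ioi (by positivity) (by positivity),
      Real.div_rpow zero_le_one (by positivity), Real.one_rpow]
    ring
  have hmeas : Measurable (Function.uncurry f) := by
    simp only [hf, Function.uncurry_def]
    fun_prop
  have hint : Integrable (Function.uncurry f)
      ((volume.restrict (Set.Ioi 0)).prod (volume.restrict (Set.Ioc 0 s))) := by
    -- As `f ≥ 0` on the domain, the `lam`-integral of its norm is the function in `hfint`, which is
    -- continuous on `[0, s]`.
    rw [integrable_prod_iff' hmeas.aestronglyMeasurable]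
    refine ⟨(ae_restrict_iff' measurableSet_Ioc).2
      (Filter.Eventually.of_forall fun x hx => hfi x hx.1), ?_⟩
    have hcont : ContinuousOn (fun x => Real.Gamma (α + m) / Real.Gamma m
        * (x ^ (m - 1) / (C + x) ^ (α + m))) (Set.Icc 0 s) := by
      refine continuousOn_const.mul ((continuousOn_id.pow _).div ?_ fun x hx => ?_)
      · exact ContinuousOn.rpow_const (by fun_prop) fun x hx => Or.inl (by linarith [hx.1])
      · exact (Real.rpow_pos_of_pos (by linarith [hx.1]) _).ne'
    refine IntegrableOn.congr_fun (hcont.integrableOn_Icc.mono_set Set.Ioc_subset_Icc_self)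
      (fun x hx => ?_) measurableSet_Ioc
    rw [← hfint x hx.1]
    refine setIntegral_congr_fun measurableSet_Ioi fun lam hlam => ?_
    have h1 : (0 : ℝ) < lam := hlam
    have h2 : 0 < x := hx.1
    exact (Real.norm_of_nonneg (show 0 ≤ f lam x by simp only [hf]; positivity)).symm
  have hswap := integral_integral_swap hint
  rw [setIntegral_congr_fun measurableSet_Ioc fun x hx => hfint x hx.1] at hswap
  simp only [hf, integral_const_mul] at hswap ⊢
  rw [hswap, ← intervalIntegral.integral_of_le hs, regIncBeta,
    if_neg (not_lt.2 (by positivity)), incBeta_one hm' hα, incBeta_eq_integral hm hC hs,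
    add_comm (m : ℝ) α]
  have h1 := (Real.rpow_pos_of_pos hC α).ne'
  have h2 := (Real.Gamma_pos_of_pos hα).ne'
  have h3 := (Real.Gamma_pos_of_pos (add_pos hα hm')).ne'
  field_simp

/-- For `s < 0` the gamma law puts no mass below `s`, and `hs` makes the argument of `regIncBeta`
negative, so both sides vanish. -/
theorem integral_pow_mul_exp_mul_gamma_cdf {a b t s : ℝ} (ha : 0 < a) (hb : 0 < b) (ht : 0 ≤ t)
    (l : ℕ) {m : ℕ} (hm : 0 < m) (hs : 0 < b + t + s) :
    ∫ lam, lam ^ l * (Real.exp (-(lam * t)) *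
        ∫ x, (if x ≤ s then 1 else 0) ∂(erlang m lam)) ∂(gammaMeasure a b)
      = b ^ a / Real.Gamma a * (Real.Gamma (a + l) / (b + t) ^ (a + l)
          * regIncBeta (s / (b + t + s)) m (a + l)) := by
  have hm' : (0 : ℝ) < m := by exact_mod_cast hm
  have hcdf : ∀ lam, 0 < lam → ∫ x, (if x ≤ s then (1 : ℝ) else 0) ∂(erlang m lam)
      = ∫ x in Set.Ioc 0 s,
          lam ^ (m : ℝ) / Real.Gamma m * x ^ ((m : ℝ) - 1) * Real.exp (-(lam * x)) := by
    intro lam hlam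
    simp only [erlang, hm.ne', if_false]
    rw [integral_gammaMeasure hm' hlam, ← Set.Ioi_inter_Iic,
      ← setIntegral_indicator measurableSet_Iic]
    congr 1
    funext x
    by_cases hx : x ≤ s <;> simp [hx]
  rcases le_or_gt 0 s with h0 | h0
  · rw [← integral_gamma_mul_gamma_cdf hm (by positivity) h0 (by positivity),
      integral_gammaMeasure ha hb, ← integral_const_mul]
    refine setIntegral_congr_fun measurableSet_Ioi fun lam hlam => ?_
    rw [hcdf lam hlam, ← mul_assoc (lam ^ l), ← mul_assoc, gamma_density_mul_pow_mul_exp l t hlam,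
      mul_assoc]
  · rw [regIncBeta, if_pos (div_neg_of_neg_of_pos h0 hs), mul_zero, mul_zero]
    refine integral_eq_zero_of_ae ?_
    filter_upwards [ae_pos_gammaMeasure a b] with lam hlam
    simp [hcdf lam hlam, Set.Ioc_eq_empty (not_lt.2 h0.le)]

/-! ### The rejection region -/

/-- The counter, truncated at `n`. -/
noncomputable def countFun (n : ℕ) : BoundedFun :=
  ⟨fun m _ => if m ≤ n then m else 0, fun _ => measurable_const, n, fun m _ => by
    dsimp only
    split_ifs with h
    · simpa using h
    · simp⟩

/-- The truncation serves only to make the counter bounded; it is harmless because `numFailures`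
never exceeds `n`. -/
theorem countFun_apply {n m : ℕ} (h : m ≤ n) (y : ℝ) : (countFun n).1 m y = m := if_pos h

/-- The indicator of rejection, as a function of the number of failures and the total time. -/
noncomputable def rejectFun (ζ : ℝ) : BoundedFun :=
  ⟨fun m y => if m = 0 then (if ζ = 0 then 1 else 0) else if ζ = 0 ∨ y ≤ m / ζ then 1 else 0, by
    refine ⟨fun m => ?_, 1, fun m y => by dsimp only; split_ifs <;> simp⟩
    refine Measurable.ite (MeasurableSet.const _) measurable_const
      (Measurable.ite ?_ measurable_const measurable_const)
    exact (MeasurableSet.const _).union measurableSet_Iic⟩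

theorem rejectFun_apply (ζ : ℝ) (m : ℕ) (y : ℝ) : (rejectFun ζ).1 m y =
    if m = 0 then (if ζ = 0 then 1 else 0) else if ζ = 0 ∨ y ≤ m / ζ then 1 else 0 := rfl

theorem ae_pos_lifetimes (n : ℕ) {r : ℝ} (hr : 0 < r) :
    ∀ᵐ x ∂(lifetimes n r), ∀ i, 0 < x i := by
  have := isProbabilityMeasure_expMeasure hr
  exact ae_all_iff.2 fun i => Measure.tendsto_eval_ae_ae.eventually (ae_pos_gammaMeasure 1 r)

theorem totalTime_pos {n : ℕ} {τ : ℝ} {x : Fin n → ℝ} (hx : ∀ i, 0 < x i)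
    (hM : numFailures τ x ≠ 0) : 0 < totalTime τ x := by
  obtain ⟨i, hi⟩ := Finset.card_pos.1 (Nat.pos_of_ne_zero hM)
  -- A failure at a positive time forces `τ > 0`, so every `min (x j) τ` is positive.
  have hτ : 0 < τ := (hx i).trans_le (Finset.mem_filter.1 hi).2
  rw [totalTime_eq_sum_min]
  exact Finset.sum_pos (fun j _ => lt_min (hx j) hτ) ⟨i, Finset.mem_univ i⟩

/-- Without failures the estimator is `0`, which is rejected exactly when `ζ = 0`: this yields the
separate indicator term of the formula. With failures the total time is positive, and `M / T < ζ`
becomes `M / ζ < T`. -/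
theorem rateEstimator_lt_iff {n : ℕ} {τ ζ : ℝ} (hζ : 0 ≤ ζ) {x : Fin n → ℝ} (hx : ∀ i, 0 < x i) :
    rateEstimator τ x < ζ ↔ (rejectFun ζ).1 (numFailures τ x) (totalTime τ x) = 0 := by
  rw [rateEstimator, rejectFun_apply]
  by_cases hM : numFailures τ x = 0
  · rcases hζ.eq_or_lt with rfl | h
    · simp [hM]
    · simp [hM, h, h.ne']
  · have hT := totalTime_pos hx hM
    rcases hζ.eq_or_lt with rfl | h
    · simp only [hM, if_false, true_or, if_true, one_ne_zero, iff_false, not_lt]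
      positivity
    · simp only [hM, if_false, h.ne', false_or, ite_eq_right_iff, one_ne_zero, imp_false, not_le]
      rw [div_lt_iff₀ hT, div_lt_iff₀ h, mul_comm]

/-- The loss is the cost of acceptance plus, on rejection, the excess cost `Cr - a0 - a1 * lam - a2
* lam ^ 2`, whose coefficients are `coeffC`. -/
theorem loss_decision (c : Costs) {n : ℕ} {τ ζ : ℝ} (hζ : 0 ≤ ζ) (lam : ℝ) {x : Fin n → ℝ}
    (hx : ∀ i, 0 < x i) :
    loss c τ lam x (decision τ ζ x)
      = (n * (c.Cs - c.rs) + τ * c.Ct + c.a0 + c.a1 * lam + c.a2 * lam ^ 2)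
        + c.rs * numFailures τ x
        + (∑ l : Fin 3, coeffC c l * lam ^ (l : ℕ))
          * (rejectFun ζ).1 (numFailures τ x) (totalTime τ x) := by
  have hsum : ∑ l : Fin 3, coeffC c l * lam ^ (l : ℕ)
      = c.Cr - c.a0 - c.a1 * lam - c.a2 * lam ^ 2 := by
    simp [Fin.sum_univ_three, coeffC]
    ring
  rw [hsum, decision]
  by_cases h : rateEstimator τ x < ζ
  · rw [if_pos h, (rateEstimator_lt_iff hζ hx).1 h, loss]
    ring
  · have h1 : (rejectFun ζ).1 (numFailures τ x) (totalTime τ x) = 1 := by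
      have h0 := mt (rateEstimator_lt_iff hζ hx).2 h
      rw [rejectFun_apply] at h0 ⊢
      split_ifs at h0 ⊢ <;> simp_all
    rw [if_neg h, h1, loss]
    ring

/-! ### Conditional expectations given the rate -/

/-- The probability of rejection, given the rate. -/
noncomputable def rejectProb (n : ℕ) (τ ζ lam : ℝ) : ℝ :=
  ∫ x : Fin n → ℝ, (rejectFun ζ).1 (numFailures τ x) (totalTime τ x) ∂(lifetimes n lam)

theorem integrable_numFailures (n : ℕ) (τ : ℝ) {lam : ℝ} (hlam : 0 < lam) :
    Integrable (fun x : Fin n → ℝ => (numFailures τ x : ℝ)) (lifetimes n lam) := by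
  have := isProbabilityMeasure_lifetimes n hlam
  refine ((countFun n).integrable_comp (measurable_numFailures n τ)
    (measurable_totalTime n τ)).congr (Filter.Eventually.of_forall fun x => ?_)
  exact countFun_apply (numFailures_le τ x) _

theorem integrable_rejectFun (n : ℕ) (τ ζ : ℝ) {lam : ℝ} (hlam : 0 < lam) :
    Integrable (fun x : Fin n → ℝ => (rejectFun ζ).1 (numFailures τ x) (totalTime τ x))
      (lifetimes n lam) := by
  have := isProbabilityMeasure_lifetimes n hlam
  exact (rejectFun ζ).integrable_comp (measurable_numFailures n τ) (measurable_totalTime n τ)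

theorem integrable_loss_decision (c : Costs) (n : ℕ) (τ : ℝ) {ζ lam : ℝ} (hζ : 0 ≤ ζ)
    (hlam : 0 < lam) :
    Integrable (fun x : Fin n → ℝ => loss c τ lam x (decision τ ζ x)) (lifetimes n lam) := by
  have := isProbabilityMeasure_lifetimes n hlam
  have hae : (fun x : Fin n → ℝ => loss c τ lam x (decision τ ζ x)) =ᵐ[lifetimes n lam] _ :=
    (ae_pos_lifetimes n hlam).mono fun x hx => loss_decision c hζ lam hx
  rw [integrable_congr hae]
  exact ((integrable_const _).add ((integrable_numFailures n τ hlam).const_mul c.rs)).add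
    ((integrable_rejectFun n τ ζ hlam).const_mul _)

theorem conditionalRisk_eq (c : Costs) (n : ℕ) (τ : ℝ) {ζ lam : ℝ} (hζ : 0 ≤ ζ)
    (hlam : 0 < lam) :
    conditionalRisk c n τ ζ lam
      = (n * (c.Cs - c.rs) + τ * c.Ct + c.a0) + c.a1 * lam ^ 1 + c.a2 * lam ^ 2
        + c.rs * conditionalFailures n τ lam
        + ∑ l : Fin 3, coeffC c l * (lam ^ (l : ℕ) * rejectProb n τ ζ lam) := by
  have := isProbabilityMeasure_lifetimes n hlam
  have hae : (fun x : Fin n → ℝ => loss c τ lam x (decision τ ζ x)) =ᵐ[lifetimes n lam] _ :=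
    (ae_pos_lifetimes n hlam).mono fun x hx => loss_decision c hζ lam hx
  have hM := (integrable_numFailures n τ hlam).const_mul c.rs
  have hKM : Integrable (fun x : Fin n → ℝ => (n * (c.Cs - c.rs) + τ * c.Ct + c.a0
      + c.a1 * lam + c.a2 * lam ^ 2) + c.rs * numFailures τ x) (lifetimes n lam) :=
    (integrable_const _).add hM
  rw [conditionalRisk, integral_congr_ae hae, integral_add hKM
    ((integrable_rejectFun n τ ζ hlam).const_mul _), integral_add (integrable_const _) hM,
    integral_const_mul, integral_const_mul, integral_const]
  simp only [probReal_univ, smul_eq_mul, ← mul_assoc, ← Finset.sum_mul]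
  rw [conditionalFailures, rejectProb]
  ring

/-- The counter ignores the clock, so each gamma law contributes its total mass `1`. The factor `lam
^ 0` prepares the use of `integral_pow_mul_exp` with `l = 0`. -/
theorem conditionalFailures_eq {n : ℕ} {τ lam : ℝ} (hτ : 0 ≤ τ) (hlam : 0 < lam) :
    conditionalFailures n τ lam
      = ∑ m ∈ Finset.range (n + 1), ∑ j ∈ Finset.range (m + 1),
        ((-1 : ℝ) ^ j * n.choose m * m.choose j) *
          (m * (lam ^ 0 * Real.exp (-(lam * ((n - m + j : ℕ) * τ))))) := by
  have h := integral_lifetimes hlam hτ n (countFun n)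
  simp only [countFun_apply (numFailures_le τ _)] at h
  rw [conditionalFailures, h]
  refine Finset.sum_congr rfl fun m hm => Finset.sum_congr rfl fun j _ => ?_
  have := isProbabilityMeasure_erlang m hlam
  simp only [countFun_apply (Nat.lt_succ_iff.1 (Finset.mem_range.1 hm)), integral_const,
    probReal_univ, smul_eq_mul]
  ring

theorem rejectProb_eq {n : ℕ} {τ lam : ℝ} (hτ : 0 ≤ τ) (ζ : ℝ) (hlam : 0 < lam) (l : ℕ) :
    lam ^ l * rejectProb n τ ζ lam
      = ∑ m ∈ Finset.range (n + 1), ∑ j ∈ Finset.range (m + 1),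
        ((-1 : ℝ) ^ j * n.choose m * m.choose j) *
          (lam ^ l * (Real.exp (-(lam * ((n - m + j : ℕ) * τ)))
            * ∫ x, (rejectFun ζ).1 m ((n - m + j : ℕ) * τ + x) ∂(erlang m lam))) := by
  rw [rejectProb, integral_lifetimes hlam hτ n (rejectFun ζ)]
  simp only [Finset.mul_sum]
  refine Finset.sum_congr rfl fun m _ => Finset.sum_congr rfl fun j _ => ?_
  ring

/-! ### Expectations over the prior -/

theorem integrable_conditionalFailures {a b : ℝ} (ha : 0 < a) (hb : 0 < b) (n : ℕ) {τ : ℝ}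
    (hτ : 0 ≤ τ) : Integrable (conditionalFailures n τ) (gammaMeasure a b) := by
  have hae : conditionalFailures n τ =ᵐ[gammaMeasure a b] _ :=
    (ae_pos_gammaMeasure a b).mono fun lam hlam => conditionalFailures_eq hτ hlam
  rw [integrable_congr hae]
  exact integrable_finsetSum _ fun m _ => integrable_finsetSum _ fun j _ =>
    ((integrable_pow_mul_exp ha hb (by positivity) 0).const_mul _).const_mul _

/-- Isolates the event of no failure, which adds nothing to `E(M)` and gives the `ζ = 0` term of the
rejection probability. -/
theorem sum_range_succ_eq_add_sum_Icc (n : ℕ) (f : ℕ → ℝ) :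
    ∑ m ∈ Finset.range (n + 1), f m = f 0 + ∑ m ∈ Finset.Icc 1 n, f m := by
  rw [Finset.range_eq_Ico, Finset.sum_eq_sum_Ico_succ_bot (Nat.succ_pos n)]
  rfl

theorem expectedFailures_eq {a b : ℝ} (ha : 0 < a) (hb : 0 < b) (n : ℕ) {τ : ℝ} (hτ : 0 ≤ τ) :
    expectedFailures a b n τ =
      ∑ m ∈ Finset.Icc 1 n, ∑ j ∈ Finset.range (m + 1),
        (m : ℝ) * (n.choose m : ℝ) * (m.choose j : ℝ) * (-1 : ℝ) ^ j
          * (b ^ a / (b + ((n : ℝ) - m + j) * τ) ^ a) := by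
  have hint := fun m j : ℕ =>
    ((integrable_pow_mul_exp ha hb (mul_nonneg (Nat.cast_nonneg (n - m + j)) hτ) 0).const_mul
      (m : ℝ)).const_mul ((-1 : ℝ) ^ j * n.choose m * m.choose j)
  have hae : conditionalFailures n τ =ᵐ[gammaMeasure a b] _ :=
    (ae_pos_gammaMeasure a b).mono fun lam hlam => conditionalFailures_eq hτ hlam
  rw [expectedFailures, integral_congr_ae hae,
    integral_finsetSum _ fun m _ => integrable_finsetSum _ fun j _ => hint m j,
    sum_range_succ_eq_add_sum_Icc]
  simp only [integral_finsetSum _ fun j _ => hint _ j, integral_const_mul,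
    integral_pow_mul_exp ha hb (mul_nonneg (Nat.cast_nonneg _) hτ)]
  simp only [Nat.cast_zero, zero_mul, mul_zero, Finset.sum_const_zero, zero_add, add_zero]
  refine Finset.sum_congr rfl fun m hm => Finset.sum_congr rfl fun j _ => ?_
  rw [Nat.cast_add, Nat.cast_sub (Finset.mem_Icc.1 hm).2]
  have := (Real.Gamma_pos_of_pos ha).ne'
  field_simp

theorem measurable_rejectFun_add (ζ : ℝ) (m : ℕ) (y : ℝ) :
    Measurable fun x => (rejectFun ζ).1 m (y + x) :=
  ((rejectFun ζ).measurable m).comp (measurable_const_add y)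

theorem integrable_pow_mul_exp_mul_integral_rejectFun {a b t : ℝ} (ha : 0 < a) (hb : 0 < b)
    (ht : 0 ≤ t) (ζ : ℝ) (l m : ℕ) :
    Integrable (fun lam => lam ^ l * (Real.exp (-(lam * t))
      * ∫ x, (rejectFun ζ).1 m (t + x) ∂(erlang m lam))) (gammaMeasure a b) := by
  obtain ⟨K, hK⟩ := (rejectFun ζ).exists_bound
  exact integrable_pow_mul_exp_mul_integral_erlang ha hb ht l m (measurable_rejectFun_add ζ m t)
    fun x => hK _ _

theorem integral_pow_mul_exp_mul_integral_rejectFun_zero {a b t : ℝ} (ha : 0 < a) (hb : 0 < b)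
    (ht : 0 ≤ t) (ζ : ℝ) (l : ℕ) :
    ∫ lam, lam ^ l * (Real.exp (-(lam * t))
      * ∫ x, (rejectFun ζ).1 0 (t + x) ∂(erlang 0 lam)) ∂(gammaMeasure a b)
      = b ^ a / Real.Gamma a * (Real.Gamma (a + l) / (b + t) ^ (a + l)
          * if ζ = 0 then 1 else 0) := by
  simp only [rejectFun_apply, if_true, erlang, integral_dirac, ← mul_assoc]
  rw [integral_mul_const, integral_pow_mul_exp ha hb ht, mul_assoc]

/-- With `t = (n - m + j) τ`, rejection for `ζ > 0` means `x ≤ s` where `s = m / ζ - t`, and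
`SstarJM` equals `s / (b + t + s)`. The denominator is `b + m / ζ > 0` even if `s < 0`. For `ζ = 0`
rejection is certain and the beta factor is `1`. -/
theorem integral_pow_mul_exp_mul_integral_rejectFun {a b τ ζ : ℝ} (ha : 0 < a) (hb : 0 < b)
    (hτ : 0 ≤ τ) (hζ : 0 ≤ ζ) {n m : ℕ} (hm : 0 < m) (hmn : m ≤ n) (j l : ℕ) :
    ∫ lam, lam ^ l * (Real.exp (-(lam * ((n - m + j : ℕ) * τ)))
      * ∫ x, (rejectFun ζ).1 m ((n - m + j : ℕ) * τ + x) ∂(erlang m lam)) ∂(gammaMeasure a b)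
      = b ^ a / Real.Gamma a * (Real.Gamma (a + l) / (CJM b n τ j m) ^ (a + l)
          * regIncBeta (SstarJM b n τ ζ j m) m (a + l)) := by
  have hm' : (0 : ℝ) < m := by exact_mod_cast hm
  have ht : 0 ≤ ((n - m + j : ℕ) : ℝ) * τ := by positivity
  have hmt : m * tauJM n τ j m = ((n - m + j : ℕ) : ℝ) * τ := by
    rw [tauJM, Nat.cast_add, Nat.cast_sub hmn]
    field_simp
  have hC : CJM b n τ j m = b + ((n - m + j : ℕ) : ℝ) * τ := by rw [CJM, hmt]
  rw [hC]
  set t := ((n - m + j : ℕ) : ℝ) * τ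
  rcases hζ.eq_or_lt with rfl | h
  · have hbeta : regIncBeta (SstarJM b n τ 0 j m) m (a + l) = 1 := by
      have hl : 0 < a + l := by positivity
      rw [SstarJM, if_pos rfl, regIncBeta, if_neg (by norm_num), incBeta_one hm' hl]
      have := Real.Gamma_pos_of_pos hm'
      have := Real.Gamma_pos_of_pos hl
      have := Real.Gamma_pos_of_pos (add_pos hm' hl)
      exact div_self (by positivity)
    rw [hbeta, mul_one, ← integral_pow_mul_exp ha hb ht]
    refine integral_congr_ae ?_
    filter_upwards [ae_pos_gammaMeasure a b] with lam hlam
    have := isProbabilityMeasure_erlang m hlam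
    simp [rejectFun_apply, hm.ne']
  · have hS : SstarJM b n τ ζ j m = (m / ζ - t) / (b + t + (m / ζ - t)) := by
      have h1 : 0 < b + t := by positivity
      have h2 : 0 < b + t + (m / ζ - t) := by
        rw [show b + t + (m / ζ - t) = b + m / ζ by ring]
        positivity
      have hst : CstarJM b n τ ζ j m = (m / ζ - t) / (b + t) := by
        rw [CstarJM, hC, mul_sub, hmt]
        ring
      rw [SstarJM, if_neg h.ne', hst]
      rw [show 1 + (m / ζ - t) / (b + t) = (b + t + (m / ζ - t)) / (b + t) by field_simp,
        div_div_div_cancel_right₀ h1.ne']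
    rw [hS, ← integral_pow_mul_exp_mul_gamma_cdf ha hb ht l hm (by
      rw [show b + t + (m / ζ - t) = b + m / ζ by ring]
      positivity)]
    simp only [rejectFun_apply, hm.ne', if_false, h.ne', false_or, le_sub_iff_add_le']

theorem integrable_pow_mul_rejectProb {a b : ℝ} (ha : 0 < a) (hb : 0 < b) (n : ℕ) {τ : ℝ}
    (hτ : 0 ≤ τ) (ζ : ℝ) (l : ℕ) :
    Integrable (fun lam => lam ^ l * rejectProb n τ ζ lam) (gammaMeasure a b) := by
  have hae : (fun lam => lam ^ l * rejectProb n τ ζ lam) =ᵐ[gammaMeasure a b] _ :=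
    (ae_pos_gammaMeasure a b).mono fun lam hlam => rejectProb_eq hτ ζ hlam l
  rw [integrable_congr hae]
  exact integrable_finsetSum _ fun m _ => integrable_finsetSum _ fun j _ =>
    (integrable_pow_mul_exp_mul_integral_rejectFun ha hb (by positivity) ζ l m).const_mul _

theorem integral_pow_mul_rejectProb {a b τ ζ : ℝ} (ha : 0 < a) (hb : 0 < b) (n : ℕ)
    (hτ : 0 ≤ τ) (hζ : 0 ≤ ζ) (l : ℕ) :
    ∫ lam, lam ^ l * rejectProb n τ ζ lam ∂(gammaMeasure a b)
      = b ^ a / Real.Gamma a *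
          (Real.Gamma (a + l) / (b + n * τ) ^ (a + l) * (if ζ = 0 then 1 else 0)
            + ∑ m ∈ Finset.Icc 1 n, ∑ j ∈ Finset.range (m + 1),
                (-1 : ℝ) ^ j * (n.choose m : ℝ) * (m.choose j : ℝ)
                  * (Real.Gamma (a + l) / (CJM b n τ j m) ^ (a + l))
                  * regIncBeta (SstarJM b n τ ζ j m) m (a + l)) := by
  have hint := fun m j : ℕ => (integrable_pow_mul_exp_mul_integral_rejectFun ha hb
      (mul_nonneg (Nat.cast_nonneg (n - m + j)) hτ) ζ l m).const_mul
        ((-1 : ℝ) ^ j * n.choose m * m.choose j)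
  have hae : (fun lam => lam ^ l * rejectProb n τ ζ lam) =ᵐ[gammaMeasure a b] _ :=
    (ae_pos_gammaMeasure a b).mono fun lam hlam => rejectProb_eq hτ ζ hlam l
  rw [integral_congr_ae hae,
    integral_finsetSum _ fun m _ => integrable_finsetSum _ fun j _ => hint m j,
    sum_range_succ_eq_add_sum_Icc]
  simp only [integral_finsetSum _ fun j _ => hint _ j, integral_const_mul]
  rw [mul_add, Finset.mul_sum]
  congr 1
  · rw [zero_add, Finset.sum_range_one,
      integral_pow_mul_exp_mul_integral_rejectFun_zero ha hb (by positivity)]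
    simp
  · refine Finset.sum_congr rfl fun m hm => ?_
    rw [Finset.mul_sum]
    refine Finset.sum_congr rfl fun j _ => ?_
    rw [integral_pow_mul_exp_mul_integral_rejectFun ha hb hτ hζ (Finset.mem_Icc.1 hm).1
      (Finset.mem_Icc.1 hm).2]
    ring

end TypeICensoring

open TypeICensoring in
theorem theorem3p1 (c : TypeICensoring.Costs) (a b : ℝ) (ha : 0 < a) (hb : 0 < b)
    (n : ℕ) (τ ζ : ℝ) (hτ : 0 ≤ τ) (hζ : 0 ≤ ζ) :
    -- the expectations that enter the formula exist
    (∀ lam : ℝ, 0 < lam →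
      Integrable (fun x : Fin n → ℝ =>
          TypeICensoring.loss c τ lam x (TypeICensoring.decision τ ζ x))
        (TypeICensoring.lifetimes n lam)) ∧
    Integrable (TypeICensoring.conditionalRisk c n τ ζ) (gammaMeasure a b) ∧
    (∀ lam : ℝ, 0 < lam →
      Integrable (fun x : Fin n → ℝ => (TypeICensoring.numFailures τ x : ℝ))
        (TypeICensoring.lifetimes n lam)) ∧
    Integrable (TypeICensoring.conditionalFailures n τ) (gammaMeasure a b) ∧
    Integrable (fun lam : ℝ => lam ^ 1) (gammaMeasure a b) ∧
    Integrable (fun lam : ℝ => lam ^ 2) (gammaMeasure a b) ∧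
    -- the Bayes risk
    TypeICensoring.bayesRisk c a b n τ ζ =
      n * (c.Cs - c.rs) + TypeICensoring.expectedFailures a b n τ * c.rs + τ * c.Ct
        + c.a0 + c.a1 * TypeICensoring.priorMoment a b 1 + c.a2 * TypeICensoring.priorMoment a b 2
        + ∑ l : Fin 3, TypeICensoring.coeffC c l * (b ^ a / Real.Gamma a) *
            (Real.Gamma (a + (l : ℕ)) / (b + n * τ) ^ (a + (l : ℕ)) * (if ζ = 0 then 1 else 0)
              + ∑ m ∈ Finset.Icc 1 n, ∑ j ∈ Finset.range (m + 1),
                  (-1 : ℝ) ^ j * (n.choose m : ℝ) * (m.choose j : ℝ)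
                    * (Real.Gamma (a + (l : ℕ))
                        / (TypeICensoring.CJM b n τ j m) ^ (a + (l : ℕ)))
                    * TypeICensoring.regIncBeta (TypeICensoring.SstarJM b n τ ζ j m)
                        m (a + (l : ℕ))) ∧
    -- the expected number of failures
    TypeICensoring.expectedFailures a b n τ =
      ∑ m ∈ Finset.Icc 1 n, ∑ j ∈ Finset.range (m + 1),
        (m : ℝ) * (n.choose m : ℝ) * (m.choose j : ℝ) * (-1 : ℝ) ^ j
          * (b ^ a / (b + ((n : ℝ) - m + j) * τ) ^ a) := by
  have hpow := integrable_pow_gammaMeasure ha hb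
  have hM := integrable_conditionalFailures ha hb n hτ
  have hR := integrable_pow_mul_rejectProb ha hb n hτ ζ
  have := isProbabilityMeasure_gammaMeasure ha hb
  have hae : conditionalRisk c n τ ζ =ᵐ[gammaMeasure a b] _ :=
    (ae_pos_gammaMeasure a b).mono fun lam hlam => conditionalRisk_eq c n τ hζ hlam
  have h1 : Integrable (fun lam : ℝ => (n * (c.Cs - c.rs) + τ * c.Ct + c.a0) + c.a1 * lam ^ 1)
    (gammaMeasure a b) := (integrable_const _).add ((hpow 1).const_mul c.a1)
  have h2 : Integrable (fun lam : ℝ => (n * (c.Cs - c.rs) + τ * c.Ct + c.a0) + c.a1 * lam ^ 1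
    + c.a2 * lam ^ 2) (gammaMeasure a b) := h1.add ((hpow 2).const_mul c.a2)
  have h3 : Integrable (fun lam : ℝ => (n * (c.Cs - c.rs) + τ * c.Ct + c.a0) + c.a1 * lam ^ 1
    + c.a2 * lam ^ 2 + c.rs * conditionalFailures n τ lam) (gammaMeasure a b) :=
    h2.add (hM.const_mul c.rs)
  have h4 : Integrable (fun lam => ∑ l : Fin 3, coeffC c l * (lam ^ (l : ℕ) * rejectProb n τ ζ lam))
      (gammaMeasure a b) := integrable_finsetSum _ fun l _ => (hR l).const_mul _
  refine ⟨fun lam hlam => integrable_loss_decision c n τ hζ hlam, (h3.add h4).congr hae.symm,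
    fun lam hlam => integrable_numFailures n τ hlam, hM, hpow 1, hpow 2, ?_,
    expectedFailures_eq ha hb n hτ⟩
  rw [TypeICensoring.bayesRisk, integral_congr_ae hae, integral_add h3 h4, integral_add h2 (hM.const_mul c.rs),
    integral_add h1 ((hpow 2).const_mul c.a2),
    integral_add (integrable_const _) ((hpow 1).const_mul c.a1),
    integral_finsetSum _ fun (l : Fin 3) _ => (hR l).const_mul (coeffC c l)]
  simp only [integral_const_mul, integral_const, probReal_univ, smul_eq_mul, one_mul,
    integral_pow_mul_rejectProb ha hb n hτ hζ, mul_assoc (coeffC c _)]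
  rw [expectedFailures, priorMoment, priorMoment]
  ring
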